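/- An (associative) \emph{anneid} is a semigroup $A$ with zero $0$ together with a partial commutative addition ($a\#b$ means that $a+b$ is defined; $\#$ is a symmetric relation) such that: $0$ is addable with every element; $a\#a$ for all $a$; $a\#b$, $b\#c$ and $b\neq0$ imply $a\#c$; for each $a\neq0$ the set $A(a)=\{b\in A: b\#a\}$ is an abelian group under $+$ with neutral element $0$ (an \emph{addibility group}); and $a\#b$ implies $ca\#cb$, $ac\#bc$, $c(a+b)=ca+cb$, $(a+b)c=ac+bc$. (Equivalently, $A$ is the set of homogeneous elements of a graded ring $\bigoplus_{s}R_s$.) Let $\Delta^*$ be the set of addibility groups $A(a)$, $a\neq 0$, and $\Delta=\Delta^*\cup\{0\}$; write $A(\delta)$ for the group that defines $\delta\in\Delta^*$, and $A(0)=\{0\}$. For $\xi,\eta\in\Delta$ put $\xi\eta=0$ if $A(\xi)A(\eta)=0$, and otherwise let $\xi\eta$ be the unique $\zeta\in\Delta$ with $A(\xi)A(\eta)\subseteq A(\zeta)$. If $\epsilon\in\Delta^*$ is idempotent, $A(\epsilon)$ is a ring (not necessarily with unity). The anneid $A$ is \emph{regular} if $0\neq ac\#bc\neq0$ implies $a\#b$,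 and $0\neq ca\#cb\neq0$ implies $a\#b$, for all $a,b,c\in A$. A nonempty $I\subseteq A$ is a \emph{right ideal} if $a-b\in I$ for all $a,b\in I$ with $a\#b$, and $ax\in I$ for all $a\in I$, $x\in A$; it is an \emph{ideal} if moreover $xa\in I$ for all $a\in I$, $x\in A$. For a right ideal $I$, $\check I$ is the largest ideal of $A$ contained in $I$. For an ideal $P$, the factor anneid $A/P$ is the set of classes of the relation: $a\sim b$ if and only if $a,b\in P$, or $a\#b$ and $a-b\in P$; its operations are induced from $A$, two classes being addable if they have addable representatives. The \emph{graded Brown--McCoy radical} $G(A)$ is the intersection of all maximal (proper) right ideals $I$ of $A$ such that $A/\check I$ is a regular anneid with unity whose only ideals are $0$ and itself (with $G(A)=A$ if there are none). The \emph{classical Brown--McCoy radical} $G(R)$ of a ring $R$ is the intersection of all ideals $I$ of $R$ such that $R/I$ is a simple ring with unity (with $G(R)=R$ if there are none). \textbf{Theorem.} Let $A$ be a regular anneid such that the product in $\Delta$ of two non-idempotent elements is never a nonzero idempotent. Then for every idempotent $\epsilon\in\Delta^*$, $$G(A(\epsilon))=G(A)\cap A(\epsilon).$$ -/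

import Mathlib

/-- An (associative) anneid: a semigroup with zero carrying a partial addition. `Addable a b` is
the relation `a # b`, and `padd a b` is the sum of `a` and `b`; it is meaningful only if
`Addable a b`. For `a ≠ 0` the fields say that the elements addable with `a` form an abelian
group, with neutral element `0`. -/
class Anneid (A : Type*) extends SemigroupWithZero A, Neg A where
  Addable : A → A → Prop
  padd : A → A → A
  addable_zero (a : A) : Addable a 0
  addable_refl (a : A) : Addable a a
  addable_symm {a b : A} : Addable a b → Addable b a
  addable_trans {a b c : A} : Addable a b → Addable b c → b ≠ 0 → Addable a c
  padd_addable {a b c : A} : a ≠ 0 → Addable b a → Addable c a → Addable (padd b c) a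
  padd_assoc {a b c d : A} : a ≠ 0 → Addable b a → Addable c a → Addable d a →
    padd (padd b c) d = padd b (padd c d)
  padd_comm {a b : A} : Addable a b → padd a b = padd b a
  padd_zero (a : A) : padd a 0 = a
  neg_addable (a : A) : Addable (-a) a
  padd_neg (a : A) : padd a (-a) = 0
  addable_mul_left {a b : A} (c : A) : Addable a b → Addable (c * a) (c * b)
  addable_mul_right {a b : A} (c : A) : Addable a b → Addable (a * c) (b * c)
  mul_padd {a b : A} (c : A) : Addable a b → c * padd a b = padd (c * a) (c * b)
  padd_mul {a b : A} (c : A) : Addable a b → padd a b * c = padd (a * c) (b * c)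

namespace Anneid

/-- The difference `a - b` of addable elements. -/
def psub {A : Type*} [Anneid A] (a b : A) : A := padd a (-b)

/-- The set of all elements addable with `a`. -/
def addibilityGroup {A : Type*} [Anneid A] (a : A) : Set A := {b | Addable b a}

/-- Regularity: products can be cancelled from the addibility relation. -/
def IsRegular (A : Type*) [Anneid A] : Prop :=
  (∀ a b c : A, a * c ≠ 0 → b * c ≠ 0 → Addable (a * c) (b * c) → Addable a b) ∧
  (∀ a b c : A, c * a ≠ 0 → c * b ≠ 0 → Addable (c * a) (c * b) → Addable a b)

/-- The set `Δ = Δ* ∪ {0}` of degrees. A degree `δ` is identified with the set `A(δ)`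
(its `carrier`): the nonzero degrees are the addibility groups of nonzero elements, and the zero
degree has `A(0) = {0}`. -/
@[ext]
structure Deg (A : Type*) [Anneid A] where
  carrier : Set A
  carrier_spec : carrier = {0} ∨ ∃ a : A, a ≠ 0 ∧ carrier = addibilityGroup a

section Degrees

variable {A : Type*} [Anneid A]

/-- The degree of an element. -/
noncomputable def degree (a : A) : Deg A := by
  classical
  exact if h : a = 0 then ⟨{0}, Or.inl rfl⟩ else ⟨addibilityGroup a, Or.inr ⟨a, h, rfl⟩⟩

instance : Zero (Deg A) := ⟨⟨{0}, Or.inl rfl⟩⟩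

open Classical in
/-- Multiplication of degrees: `ξ * η` is `0` if `A(ξ) A(η) = 0`, and otherwise it is the unique
degree with `A(ξ) A(η) ⊆ A(ξ * η)`, namely the degree of any nonzero product
(see `Deg.mul_mem`). -/
noncomputable instance : Mul (Deg A) :=
  ⟨fun ξ η =>
    if h : ∃ p : A × A, p.1 ∈ ξ.carrier ∧ p.2 ∈ η.carrier ∧ p.1 * p.2 ≠ 0 then
      degree (h.choose.1 * h.choose.2)
    else 0⟩

theorem zero_addable (a : A) : Addable 0 a := addable_symm (addable_zero a)

theorem zero_padd (a : A) : padd 0 a = a := by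
  rw [padd_comm (zero_addable a), padd_zero]

theorem neg_zero' : -(0 : A) = 0 := by
  have := padd_neg (0 : A)
  rwa [zero_padd] at this

theorem mem_degree_self (a : A) : a ∈ (degree a).carrier := by
  unfold degree
  split_ifs with h
  · exact h
  · exact addable_refl a

theorem Deg.addable (D : Deg A) {a b : A} (ha : a ∈ D.carrier) (hb : b ∈ D.carrier) :
    Addable a b := by
  rcases D.carrier_spec with h | ⟨c, hc, h⟩
  · rw [h] at ha hb
    rw [Set.mem_singleton_iff.1 ha, Set.mem_singleton_iff.1 hb]
    exact addable_refl 0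
  · rw [h] at ha hb
    exact addable_trans ha (addable_symm hb) hc

theorem Deg.zero_mem (D : Deg A) : (0 : A) ∈ D.carrier := by
  rcases D.carrier_spec with h | ⟨c, hc, h⟩
  · rw [h]; rfl
  · rw [h]; exact zero_addable c

theorem Deg.padd_mem (D : Deg A) {a b : A} (ha : a ∈ D.carrier) (hb : b ∈ D.carrier) :
    padd a b ∈ D.carrier := by
  rcases D.carrier_spec with h | ⟨c, hc, h⟩
  · rw [h] at ha hb ⊢
    rw [Set.mem_singleton_iff.1 ha, Set.mem_singleton_iff.1 hb]
    exact padd_zero 0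
  · rw [h] at ha hb ⊢
    exact padd_addable hc ha hb

theorem Deg.mem_of_addable (D : Deg A) {a b : A} (ha : a ∈ D.carrier) (h0 : a ≠ 0)
    (hb : Addable b a) : b ∈ D.carrier := by
  rcases D.carrier_spec with h | ⟨c, hc, h⟩
  · rw [h] at ha
    exact absurd ha h0
  · rw [h] at ha ⊢
    exact addable_trans hb ha h0

theorem Deg.neg_mem (D : Deg A) {a : A} (ha : a ∈ D.carrier) : -a ∈ D.carrier := by
  by_cases h : a = 0
  · subst h; rw [neg_zero']; exact ha
  · exact D.mem_of_addable ha h (neg_addable a)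

theorem Addable.exists_deg {a b : A} (h : Addable a b) :
    ∃ D : Deg A, a ∈ D.carrier ∧ b ∈ D.carrier := by
  by_cases hb : b = 0
  · exact ⟨degree a, mem_degree_self a, hb ▸ (degree a).zero_mem⟩
  · exact ⟨degree b, (degree b).mem_of_addable (mem_degree_self b) hb h, mem_degree_self b⟩

instance Deg.instAdd (D : Deg A) : Add {x : A // x ∈ D.carrier} :=
  ⟨fun x y => ⟨padd x.1 y.1, D.padd_mem x.2 y.2⟩⟩

instance Deg.instZero (D : Deg A) : Zero {x : A // x ∈ D.carrier} := ⟨⟨0, D.zero_mem⟩⟩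

instance Deg.instNeg (D : Deg A) : Neg {x : A // x ∈ D.carrier} :=
  ⟨fun x => ⟨-x.1, D.neg_mem x.2⟩⟩

/-- The group structure of `A(δ)`. -/
instance Deg.addCommGroup (D : Deg A) : AddCommGroup {x : A // x ∈ D.carrier} where
  nsmul := nsmulRec
  zsmul := zsmulRec
  add_assoc x y z := by
    apply Subtype.ext
    change padd (padd x.1 y.1) z.1 = padd x.1 (padd y.1 z.1)
    by_cases h : y.1 = 0
    · rw [h, padd_zero, zero_padd]
    · exact padd_assoc h (D.addable x.2 y.2) (addable_refl _) (D.addable z.2 y.2)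
  zero_add x := Subtype.ext (zero_padd x.1)
  add_zero x := Subtype.ext (padd_zero x.1)
  add_comm x y := Subtype.ext (padd_comm (D.addable x.2 y.2))
  neg_add_cancel x := by
    apply Subtype.ext
    change padd (-x.1) x.1 = 0
    rw [padd_comm (neg_addable _), padd_neg]

theorem Deg.coe_sub (D : Deg A) (x y : {x : A // x ∈ D.carrier}) :
    ((x - y : {x : A // x ∈ D.carrier}) : A) = psub x.1 y.1 := by
  rw [sub_eq_add_neg]; rfl

theorem mul_addable_mul {x y a b : A} (h : Addable x y) (h' : Addable a b) :
    Addable (x * a) (y * b) := by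
  have h1 : Addable (x * a) (y * a) := addable_mul_right a h
  have h2 : Addable (y * a) (y * b) := addable_mul_left y h'
  have h3 : Addable (x * a) (x * b) := addable_mul_left x h'
  have h4 : Addable (x * b) (y * b) := addable_mul_right b h
  by_cases h5 : y * a = 0
  · by_cases h6 : x * b = 0
    · have h7 := addable_mul_left (padd x y) h'
      rw [padd_mul a h, padd_mul b h, h5, h6, padd_zero, zero_padd] at h7
      exact h7
    · exact addable_trans h3 h4 h6
  · exact addable_trans h1 h2 h5

theorem Deg.mul_mem {ξ η : Deg A} {x y : A} (hx : x ∈ ξ.carrier) (hy : y ∈ η.carrier) :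
    x * y ∈ (ξ * η).carrier := by
  classical
  by_cases h : ∃ p : A × A, p.1 ∈ ξ.carrier ∧ p.2 ∈ η.carrier ∧ p.1 * p.2 ≠ 0
  · have e : ξ * η = degree (h.choose.1 * h.choose.2) := dif_pos h
    rw [e]
    obtain ⟨h1, h2, h3⟩ := h.choose_spec
    exact Deg.mem_of_addable _ (mem_degree_self _) h3
      (mul_addable_mul (ξ.addable hx h1) (η.addable hy h2))
  · have e : x * y = 0 := by
      by_contra h'
      exact h ⟨(x, y), hx, hy, h'⟩
    rw [e]
    exact Deg.zero_mem _

/-- The additive group `A(ε)` for an idempotent degree `ε`, regarded as a ring. -/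
def IdemRing (ε : Deg A) (_hε : IsIdempotentElem ε) : Type _ := {x : A // x ∈ ε.carrier}

/-- The element of the anneid underlying an element of `A(ε)`. -/
def IdemRing.val {ε : Deg A} {hε : IsIdempotentElem ε} (x : IdemRing ε hε) : A := Subtype.val x

instance IdemRing.nonUnitalRing (ε : Deg A) (hε : IsIdempotentElem ε) :
    NonUnitalRing (IdemRing ε hε) where
  toAddCommGroup := Deg.addCommGroup ε
  mul x y := ⟨x.val * y.val, by
    have h := Deg.mul_mem (A := A) x.2 y.2
    rw [hε] at h
    exact h⟩
  left_distrib x y z := Subtype.ext (mul_padd _ (ε.addable y.2 z.2))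
  right_distrib x y z := Subtype.ext (padd_mul _ (ε.addable x.2 y.2))
  zero_mul x := Subtype.ext (zero_mul x.val)
  mul_zero x := Subtype.ext (mul_zero x.val)
  mul_assoc x y z := Subtype.ext (mul_assoc x.val y.val z.val)

end Degrees

section Ideals

variable {A : Type*} [Anneid A]

/-- Right ideals of an anneid. -/
structure IsRightIdeal (I : Set A) : Prop where
  nonempty : I.Nonempty
  psub_mem : ∀ a ∈ I, ∀ b ∈ I, Addable a b → psub a b ∈ I
  mul_mem : ∀ a ∈ I, ∀ x : A, a * x ∈ I

/-- Two-sided ideals of an anneid. -/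
structure IsIdeal (I : Set A) : Prop extends IsRightIdeal I where
  mul_mem_left : ∀ a ∈ I, ∀ x : A, x * a ∈ I

/-- Maximal right ideals: the maximal elements among the proper right ideals. -/
def IsMaximalRightIdeal (I : Set A) : Prop :=
  Maximal (fun J : Set A => IsRightIdeal J ∧ J ≠ Set.univ) I

theorem IsRightIdeal.zero_mem {I : Set A} (hI : IsRightIdeal I) : (0 : A) ∈ I := by
  obtain ⟨a, ha⟩ := hI.nonempty
  simpa using hI.mul_mem a ha 0

/-- The degree-`D` part of a right ideal. -/
def IsRightIdeal.part {I : Set A} (hI : IsRightIdeal I) (D : Deg A) :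
    AddSubgroup {x : A // x ∈ D.carrier} :=
  AddSubgroup.ofSub {x | x.1 ∈ I} ⟨0, hI.zero_mem⟩ (by
    intro x hx y hy
    rw [← sub_eq_add_neg, Set.mem_ofPred_eq, Deg.coe_sub]
    exact hI.psub_mem _ hx _ hy (D.addable x.2 y.2))

theorem IsRightIdeal.padd_mem {I : Set A} (hI : IsRightIdeal I) {a b : A} (ha : a ∈ I)
    (hb : b ∈ I) (h : Addable a b) : padd a b ∈ I := by
  obtain ⟨D, h1, h2⟩ := h.exists_deg
  exact (hI.part D).add_mem (x := ⟨a, h1⟩) (y := ⟨b, h2⟩) ha hb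

theorem IsRightIdeal.neg_mem {I : Set A} (hI : IsRightIdeal I) {a : A} (ha : a ∈ I) :
    -a ∈ I :=
  (hI.part (degree a)).neg_mem (x := ⟨a, mem_degree_self a⟩) ha

/-- The sum of two ideals. -/
theorem IsIdeal.add {J K : Set A} (hJ : IsIdeal J) (hK : IsIdeal K) :
    IsIdeal {z : A | ∃ D : Deg A, ∃ x y : {x : A // x ∈ D.carrier},
      x.1 ∈ J ∧ y.1 ∈ K ∧ (x + y).1 = z} where
  nonempty := ⟨_, 0, 0, 0, hJ.zero_mem, hK.zero_mem, rfl⟩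
  psub_mem := by
    rintro _ ⟨D, x, y, hx, hy, rfl⟩ _ ⟨E, u, v, hu, hv, rfl⟩ h
    by_cases h0 : (x + y).1 = 0
    · refine ⟨E, -u, -v, (hJ.part E).neg_mem hu, (hK.part E).neg_mem hv, ?_⟩
      rw [h0, psub, zero_padd, ← neg_add]; rfl
    by_cases h1 : (u + v).1 = 0
    · refine ⟨D, x, y, hx, hy, ?_⟩
      rw [h1, psub, neg_zero', padd_zero]
    have hDE : ∀ w : A, w ∈ E.carrier → w ∈ D.carrier := fun w hw =>
      D.mem_of_addable (D.mem_of_addable (x + y).2 h0 (addable_symm h)) h1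
        (E.addable hw (u + v).2)
    have hxu := (hJ.part D).sub_mem hx (y := ⟨u.1, hDE _ u.2⟩) hu
    have hyv := (hK.part D).sub_mem hy (y := ⟨v.1, hDE _ v.2⟩) hv
    refine ⟨D, _, _, hxu, hyv, ?_⟩
    rw [sub_add_sub_comm, Deg.coe_sub]; rfl
  mul_mem := by
    rintro _ ⟨D, x, y, hx, hy, rfl⟩ c
    exact ⟨D * degree c, ⟨x.1 * c, Deg.mul_mem x.2 (mem_degree_self c)⟩,
      ⟨y.1 * c, Deg.mul_mem y.2 (mem_degree_self c)⟩, hJ.mul_mem _ hx c, hK.mul_mem _ hy c,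
      (padd_mul c (D.addable x.2 y.2)).symm⟩
  mul_mem_left := by
    rintro _ ⟨D, x, y, hx, hy, rfl⟩ c
    exact ⟨degree c * D, ⟨c * x.1, Deg.mul_mem (mem_degree_self c) x.2⟩,
      ⟨c * y.1, Deg.mul_mem (mem_degree_self c) y.2⟩, hJ.mul_mem_left _ hx c,
      hK.mul_mem_left _ hy c, (mul_padd c (D.addable x.2 y.2)).symm⟩

/-- The largest two-sided ideal contained in a right ideal `I`, described as the union of all
two-sided ideals contained in `I` (see `isGreatest_core`). -/
def core (I : Set A) : Set A := {a | ∃ J : Set A, IsIdeal J ∧ J ⊆ I ∧ a ∈ J}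

theorem IsRightIdeal.core_isIdeal {I : Set A} (hI : IsRightIdeal I) : IsIdeal (core I) where
  nonempty := by
    refine ⟨0, {0}, ⟨⟨⟨0, rfl⟩, ?_, ?_⟩, ?_⟩, ?_, rfl⟩
    · rintro _ rfl _ rfl _
      exact padd_neg 0
    · rintro _ rfl x
      exact zero_mul x
    · rintro _ rfl x
      exact mul_zero x
    · rintro _ rfl
      exact hI.zero_mem
  psub_mem := by
    rintro a ⟨J, hJ, hJI, ha⟩ b ⟨K, hK, hKI, hb⟩ h
    obtain ⟨D, h1, h2⟩ := h.exists_deg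
    refine ⟨_, hJ.add hK, ?_, D, ⟨a, h1⟩, -⟨b, h2⟩, ha, hK.neg_mem hb, rfl⟩
    rintro _ ⟨E, x, y, hx, hy, rfl⟩
    exact (hI.part E).add_mem (hJI hx) (hKI hy)
  mul_mem := by
    rintro a ⟨J, hJ, hJI, ha⟩ x
    exact ⟨J, hJ, hJI, hJ.mul_mem a ha x⟩
  mul_mem_left := by
    rintro a ⟨J, hJ, hJI, ha⟩ x
    exact ⟨J, hJ, hJI, hJ.mul_mem_left a ha x⟩

theorem isGreatest_core {I : Set A} (hI : IsRightIdeal I) :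
    IsGreatest {J : Set A | IsIdeal J ∧ J ⊆ I} (core I) :=
  ⟨⟨hI.core_isIdeal, fun _ ⟨_, _, hJ, ha⟩ => hJ ha⟩,
    fun J hJ _ ha => ⟨J, hJ.1, hJ.2, ha⟩⟩

end Ideals

section Quotients

variable {A : Type*} [Anneid A]

/-- Congruence modulo an ideal. -/
def modRel (P : Set A) (a b : A) : Prop := (a ∈ P ∧ b ∈ P) ∨ (Addable a b ∧ psub a b ∈ P)

theorem modRel_mem {P : Set A} (hP : IsIdeal P) {a b : A} (h : modRel P a b) :
    a ∈ P ↔ b ∈ P := by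
  rcases h with ⟨h1, h2⟩ | ⟨h, h1⟩
  · exact iff_of_true h1 h2
  · obtain ⟨D, ha, hb⟩ := h.exists_deg
    have h2 : (⟨a, ha⟩ - ⟨b, hb⟩ : {x : A // x ∈ D.carrier}) ∈ hP.part D := by
      change _ ∈ P
      rw [Deg.coe_sub]; exact h1
    constructor
    · intro h3
      have h4 := (hP.part D).sub_mem (x := ⟨a, ha⟩) h3 h2
      rw [sub_sub_cancel] at h4
      exact h4
    · intro h3
      have h4 := (hP.part D).add_mem h2 (y := ⟨b, hb⟩) h3
      rw [sub_add_cancel] at h4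
      exact h4

/-- Congruence modulo an ideal is an equivalence relation. -/
def modSetoid (P : Set A) (hP : IsIdeal P) : Setoid A where
  r := modRel P
  iseqv := by
    refine ⟨fun a => Or.inr ⟨addable_refl a, ?_⟩, ?_, ?_⟩
    · rw [psub, padd_neg]; exact hP.zero_mem
    · rintro a b (⟨h1, h2⟩ | ⟨h, h1⟩)
      · exact Or.inl ⟨h2, h1⟩
      · refine Or.inr ⟨addable_symm h, ?_⟩
        obtain ⟨D, ha, hb⟩ := h.exists_deg
        have e := Deg.coe_sub D ⟨b, hb⟩ ⟨a, ha⟩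
        rw [← neg_sub] at e
        rw [← e]
        apply hP.neg_mem
        rw [Deg.coe_sub]; exact h1
    · intro a b c h h'
      by_cases hb : b ∈ P
      · exact Or.inl ⟨(modRel_mem hP h).2 hb, (modRel_mem hP h').1 hb⟩
      · rcases h with h | ⟨h, h1⟩
        · exact absurd h.2 hb
        rcases h' with h' | ⟨h', h1'⟩
        · exact absurd h'.1 hb
        have hb0 : b ≠ 0 := fun e => hb (e ▸ hP.zero_mem)
        obtain ⟨D, ha, hbD⟩ := h.exists_deg
        have hc : c ∈ D.carrier := D.mem_of_addable hbD hb0 (addable_symm h')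
        refine Or.inr ⟨D.addable ha hc, ?_⟩
        have e := Deg.coe_sub D ⟨a, ha⟩ ⟨c, hc⟩
        rw [← sub_add_sub_cancel _ (⟨b, hbD⟩ : {x : A // x ∈ D.carrier})] at e
        rw [← e]
        apply (hP.part D).add_mem
        · change _ ∈ P
          rw [Deg.coe_sub]; exact h1
        · change _ ∈ P
          rw [Deg.coe_sub]; exact h1'

/-- The factor anneid `A / P`. -/
def Factor (P : Set A) (hP : IsIdeal P) : Type _ := Quotient (modSetoid P hP)

/-- The class of an element in the factor anneid. -/
def Factor.mk (P : Set A) (hP : IsIdeal P) (a : A) : Factor P hP :=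
  Quotient.mk (modSetoid P hP) a

namespace Factor

variable {P : Set A} {hP : IsIdeal P}

theorem mk_eq {a b : A} : mk P hP a = mk P hP b ↔ modRel P a b :=
  ⟨fun h => Quotient.exact (s := modSetoid P hP) h,
    fun h => Quotient.sound (s := modSetoid P hP) h⟩

theorem exists_mk (x : Factor P hP) : ∃ a, mk P hP a = x :=
  Quotient.exists_rep (s := modSetoid P hP) x

theorem mk_eq_zero {a : A} : mk P hP a = mk P hP 0 ↔ a ∈ P := by
  rw [mk_eq]
  exact ⟨fun h => (modRel_mem hP h).2 hP.zero_mem, fun h => Or.inl ⟨h, hP.zero_mem⟩⟩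

theorem mk_mul_congr {a a' b b' : A} (h : modRel P a a') (h' : modRel P b b') :
    mk P hP (a * b) = mk P hP (a' * b') := by
  have h1 : mk P hP (a * b) = mk P hP (a' * b) := by
    rw [mk_eq]
    rcases h with ⟨h1, h2⟩ | ⟨h, h1⟩
    · exact Or.inl ⟨hP.mul_mem _ h1 b, hP.mul_mem _ h2 b⟩
    · refine Or.inr ⟨addable_mul_right b h, ?_⟩
      obtain ⟨D, ha, ha'⟩ := h.exists_deg
      have h2 := hP.mul_mem _ h1 b
      rw [psub, padd_mul b (D.addable ha (D.neg_mem ha'))] at h2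
      have e : -a' * b = -(a' * b) := by
        have hm : ∀ {c : A}, c ∈ D.carrier → c * b ∈ (D * degree b).carrier :=
          fun hc => Deg.mul_mem hc (mem_degree_self b)
        have e1 : (⟨a' * b, hm ha'⟩ + ⟨-a' * b, hm (D.neg_mem ha')⟩ :
            {x : A // x ∈ (D * degree b).carrier}) = 0 := by
          apply Subtype.ext
          change padd (a' * b) (-a' * b) = 0
          rw [← padd_mul b (addable_symm (neg_addable a')), padd_neg, zero_mul]
        exact congrArg Subtype.val (neg_eq_of_add_eq_zero_right e1).symm
      rw [e] at h2
      exact h2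
  rw [h1, mk_eq]
  rcases h' with ⟨h1, h2⟩ | ⟨h, h1⟩
  · exact Or.inl ⟨hP.mul_mem_left _ h1 a', hP.mul_mem_left _ h2 a'⟩
  · refine Or.inr ⟨addable_mul_left a' h, ?_⟩
    obtain ⟨D, hb, hb'⟩ := h.exists_deg
    have h2 := hP.mul_mem_left _ h1 a'
    rw [psub, mul_padd a' (D.addable hb (D.neg_mem hb'))] at h2
    have e : a' * -b' = -(a' * b') := by
      have hm : ∀ {c : A}, c ∈ D.carrier → a' * c ∈ (degree a' * D).carrier :=
        fun hc => Deg.mul_mem (mem_degree_self a') hc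
      have e1 : (⟨a' * b', hm hb'⟩ + ⟨a' * -b', hm (D.neg_mem hb')⟩ :
          {x : A // x ∈ (degree a' * D).carrier}) = 0 := by
        apply Subtype.ext
        change padd (a' * b') (a' * -b') = 0
        rw [← mul_padd a' (addable_symm (neg_addable b')), padd_neg, mul_zero]
      exact congrArg Subtype.val (neg_eq_of_add_eq_zero_right e1).symm
    rw [e] at h2
    exact h2

theorem mk_neg_congr {a b : A} (h : modRel P a b) : mk P hP (-a) = mk P hP (-b) := by
  rw [mk_eq]
  rcases h with ⟨h1, h2⟩ | ⟨h, h1⟩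
  · exact Or.inl ⟨hP.neg_mem h1, hP.neg_mem h2⟩
  · obtain ⟨D, ha, hb⟩ := h.exists_deg
    refine Or.inr ⟨D.addable (D.neg_mem ha) (D.neg_mem hb), ?_⟩
    have e := Deg.coe_sub D (-⟨a, ha⟩) (-⟨b, hb⟩)
    rw [← neg_sub'] at e
    change _ = psub (-a) (-b) at e
    rw [← e]
    apply hP.neg_mem
    rw [Deg.coe_sub]; exact h1

/-- Classes are addable if they have addable representatives. -/
def IsAddable (x y : Factor P hP) : Prop :=
  ∃ p : A × A, mk P hP p.1 = x ∧ mk P hP p.2 = y ∧ Addable p.1 p.2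

open Classical in
/-- The sum of addable classes is the class of the sum of addable representatives
(see `sum_mk`). -/
noncomputable def sum (x y : Factor P hP) : Factor P hP :=
  if h : IsAddable x y then mk P hP (padd h.choose.1 h.choose.2) else mk P hP 0

theorem mk_padd_congr {a a' b b' : A} (ha : modRel P a a') (hb : modRel P b b')
    (h : Addable a b) (h' : Addable a' b') : mk P hP (padd a b) = mk P hP (padd a' b') := by
  -- adding an element of the ideal does not change the class
  have key : ∀ u v : A, Addable u v → v ∈ P → mk P hP (padd u v) = mk P hP u := by
    intro u v huv hv
    obtain ⟨D, hu, hvD⟩ := huv.exists_deg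
    rw [mk_eq]
    refine Or.inr ⟨D.addable (D.padd_mem hu hvD) hu, ?_⟩
    have e := Deg.coe_sub D (⟨u, hu⟩ + ⟨v, hvD⟩) ⟨u, hu⟩
    rw [add_sub_cancel_left] at e
    change v = psub (padd u v) u at e
    rw [← e]; exact hv
  by_cases h1 : b ∈ P
  · rw [key _ _ h h1, key _ _ h' ((modRel_mem hP hb).1 h1)]
    exact mk_eq.2 ha
  by_cases h2 : a ∈ P
  · rw [padd_comm h, padd_comm h', key _ _ (addable_symm h) h2,
      key _ _ (addable_symm h') ((modRel_mem hP ha).1 h2)]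
    exact mk_eq.2 hb
  rcases ha with ha | ⟨ha, ha1⟩
  · exact absurd ha.1 h2
  rcases hb with hb | ⟨hb, hb1⟩
  · exact absurd hb.1 h1
  have ha0 : a ≠ 0 := fun e => h2 (e ▸ hP.zero_mem)
  have hb0 : b ≠ 0 := fun e => h1 (e ▸ hP.zero_mem)
  obtain ⟨D, hDa, hDb⟩ := h.exists_deg
  have hDa' : a' ∈ D.carrier := D.mem_of_addable hDa ha0 (addable_symm ha)
  have hDb' : b' ∈ D.carrier := D.mem_of_addable hDb hb0 (addable_symm hb)
  rw [mk_eq]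
  refine Or.inr ⟨D.addable (D.padd_mem hDa hDb) (D.padd_mem hDa' hDb'), ?_⟩
  have e := Deg.coe_sub D (⟨a, hDa⟩ + ⟨b, hDb⟩) (⟨a', hDa'⟩ + ⟨b', hDb'⟩)
  rw [add_sub_add_comm] at e
  change _ = psub (padd a b) (padd a' b') at e
  rw [← e]
  apply (hP.part D).add_mem
  · change _ ∈ P
    rw [Deg.coe_sub]; exact ha1
  · change _ ∈ P
    rw [Deg.coe_sub]; exact hb1

theorem sum_mk {a b : A} (h : Addable a b) :
    sum (mk P hP a) (mk P hP b) = mk P hP (padd a b) := by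
  have h' : IsAddable (mk P hP a) (mk P hP b) := ⟨(a, b), rfl, rfl, h⟩
  obtain ⟨h1, h2, h3⟩ := h'.choose_spec
  rw [sum, dif_pos h']
  exact mk_padd_congr (mk_eq.1 h1) (mk_eq.1 h2) h3 h

theorem exists_addable_rep {x : Factor P hP} {a : A} (h0 : mk P hP a ≠ mk P hP 0)
    (h : IsAddable x (mk P hP a)) : ∃ b, mk P hP b = x ∧ Addable b a := by
  obtain ⟨⟨b, a'⟩, h1, h2, h3⟩ := h
  refine ⟨b, h1, ?_⟩
  have ha : a ∉ P := fun e => h0 (mk_eq_zero.2 e)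
  rcases mk_eq.1 h2 with h4 | ⟨h4, -⟩
  · exact absurd h4.2 ha
  · refine addable_trans h3 h4 ?_
    rintro e
    exact h0 (h2.symm.trans (congrArg (mk P hP) e))

theorem isAddable_symm {x y : Factor P hP} : IsAddable x y → IsAddable y x :=
  fun ⟨p, h1, h2, h3⟩ => ⟨(p.2, p.1), h2, h1, addable_symm h3⟩

/-- The anneid structure of the factor anneid. -/
noncomputable instance anneid (P : Set A) (hP : IsIdeal P) : Anneid (Factor P hP) where
  zero := mk P hP 0
  mul := Quotient.map₂ (sa := modSetoid P hP) (sb := modSetoid P hP) (sc := modSetoid P hP)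
    (· * ·) (fun _ _ h _ _ h' => mk_eq.1 (mk_mul_congr (hP := hP) h h'))
  neg := Quotient.map (sa := modSetoid P hP) (sb := modSetoid P hP) (- ·)
    (fun _ _ h => mk_eq.1 (mk_neg_congr (hP := hP) h))
  Addable := IsAddable
  padd := sum
  mul_assoc x y z := by
    obtain ⟨a, rfl⟩ := exists_mk x
    obtain ⟨b, rfl⟩ := exists_mk y
    obtain ⟨c, rfl⟩ := exists_mk z
    exact congrArg (mk P hP) (mul_assoc a b c)
  zero_mul x := by
    obtain ⟨a, rfl⟩ := exists_mk x
    exact congrArg (mk P hP) (zero_mul a)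
  mul_zero x := by
    obtain ⟨a, rfl⟩ := exists_mk x
    exact congrArg (mk P hP) (mul_zero a)
  addable_zero x := by
    obtain ⟨a, rfl⟩ := exists_mk x
    exact ⟨(a, 0), rfl, rfl, addable_zero a⟩
  addable_refl x := by
    obtain ⟨a, rfl⟩ := exists_mk x
    exact ⟨(a, a), rfl, rfl, addable_refl a⟩
  addable_symm := isAddable_symm
  addable_trans {x y z} h h' h0 := by
    obtain ⟨b, rfl⟩ := exists_mk y
    obtain ⟨a, rfl, ha⟩ := exists_addable_rep h0 h
    obtain ⟨c, rfl, hc⟩ := exists_addable_rep h0 (isAddable_symm h')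
    refine ⟨(a, c), rfl, rfl, addable_trans ha (addable_symm hc) ?_⟩
    rintro rfl
    exact h0 rfl
  padd_addable {x y z} h0 h h' := by
    obtain ⟨a, rfl⟩ := exists_mk x
    obtain ⟨b, rfl, hb⟩ := exists_addable_rep h0 h
    obtain ⟨c, rfl, hc⟩ := exists_addable_rep h0 h'
    have ha : a ≠ 0 := by rintro rfl; exact h0 rfl
    rw [sum_mk (addable_trans hb (addable_symm hc) ha)]
    exact ⟨(padd b c, a), rfl, rfl, padd_addable ha hb hc⟩
  padd_assoc {x y z w} h0 h h' h'' := by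
    obtain ⟨a, rfl⟩ := exists_mk x
    obtain ⟨b, rfl, hb⟩ := exists_addable_rep h0 h
    obtain ⟨c, rfl, hc⟩ := exists_addable_rep h0 h'
    obtain ⟨d, rfl, hd⟩ := exists_addable_rep h0 h''
    have ha : a ≠ 0 := by rintro rfl; exact h0 rfl
    rw [sum_mk (addable_trans hb (addable_symm hc) ha),
      sum_mk (addable_trans hc (addable_symm hd) ha),
      sum_mk (addable_trans (padd_addable ha hb hc) (addable_symm hd) ha),
      sum_mk (addable_trans hb (addable_symm (padd_addable ha hc hd)) ha),
      padd_assoc ha hb hc hd]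
  padd_comm {x y} h := by
    obtain ⟨⟨a, b⟩, rfl, rfl, h⟩ := h
    rw [sum_mk h, sum_mk (addable_symm h), padd_comm h]
  padd_zero x := by
    obtain ⟨a, rfl⟩ := exists_mk x
    refine (sum_mk (addable_zero a)).trans ?_
    rw [padd_zero]
  neg_addable x := by
    obtain ⟨a, rfl⟩ := exists_mk x
    exact ⟨(-a, a), rfl, rfl, neg_addable a⟩
  padd_neg x := by
    obtain ⟨a, rfl⟩ := exists_mk x
    refine (sum_mk (addable_symm (neg_addable a))).trans ?_
    rw [padd_neg]; rfl
  addable_mul_left {x y} z h := by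
    obtain ⟨⟨a, b⟩, rfl, rfl, h⟩ := h
    obtain ⟨c, rfl⟩ := exists_mk z
    exact ⟨(c * a, c * b), rfl, rfl, addable_mul_left c h⟩
  addable_mul_right {x y} z h := by
    obtain ⟨⟨a, b⟩, rfl, rfl, h⟩ := h
    obtain ⟨c, rfl⟩ := exists_mk z
    exact ⟨(a * c, b * c), rfl, rfl, addable_mul_right c h⟩
  mul_padd {x y} z h := by
    obtain ⟨⟨a, b⟩, rfl, rfl, h⟩ := h
    obtain ⟨c, rfl⟩ := exists_mk z
    rw [sum_mk h]
    refine Eq.trans ?_ (sum_mk (addable_mul_left c h)).symm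
    exact congrArg (mk P hP) (mul_padd c h)
  padd_mul {x y} z h := by
    obtain ⟨⟨a, b⟩, rfl, rfl, h⟩ := h
    obtain ⟨c, rfl⟩ := exists_mk z
    rw [sum_mk h]
    refine Eq.trans ?_ (sum_mk (addable_mul_right c h)).symm
    exact congrArg (mk P hP) (padd_mul c h)

end Factor

end Quotients

/-- The class of simple regular anneids with unity. -/
structure IsSimpleRegularUnital (B : Type*) [Anneid B] : Prop where
  regular : IsRegular B
  exists_unity : ∃ e : B, ∀ b : B, e * b = b ∧ b * e = b
  simple : ∀ J : Set B, IsIdeal J → J = {0} ∨ J = Set.univ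

/-- The graded Brown–McCoy radical `G(A)`: the intersection of all maximal right ideals `I` such
that the factor anneid of `A` by the largest two-sided ideal in `I` is a simple regular anneid
with unity. -/
def gradedBrownMcCoy (A : Type*) [Anneid A] : Set A :=
  ⋂₀ {I : Set A | ∃ hI : IsMaximalRightIdeal I,
    IsSimpleRegularUnital (Factor (core I) hI.prop.1.core_isIdeal)}

/-- In `Δ`, a product of two non-idempotent elements is never a nonzero idempotent. -/
def NoIdempotentFromNonIdempotents (A : Type*) [Anneid A] : Prop :=
  ∀ ξ η : Deg A, ¬ IsIdempotentElem ξ → ¬ IsIdempotentElem η → ξ * η ≠ 0 →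
    ¬ IsIdempotentElem (ξ * η)

end Anneid

/-- The classical Brown–McCoy radical of an associative ring, not necessarily with unity: the
intersection of all ideals `I` such that `R / I` is a simple ring with unity. -/
def brownMcCoyRadical (R : Type*) [NonUnitalRing R] : TwoSidedIdeal R :=
  sInf {I : TwoSidedIdeal R | IsSimpleRing I.ringCon.Quotient ∧
    ∃ e : I.ringCon.Quotient, ∀ x, e * x = x ∧ x * e = x}

/-! Let `Q` be an ideal of `A(ε)` modulo which `A(ε)` has a unity `u`. The crux is
`mem_and_mem_of_mul_notMem`: a product `a * b` that lies in `A(ε)` but not in `Q` has both factors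
in `A(ε)`. Multiplying by `u` and cancelling by regularity gives `ε * degree a = degree a` and
`degree b * ε = degree b`, while `degree a * degree b = ε`. By the hypothesis on `Δ`, one of the two
degrees is idempotent, and cancellation makes both equal to `ε`. Consequently `Q`, or any right
ideal of `A(ε)` containing `Q`, becomes an ideal (right ideal) of `A` once the whole complement of
`A(ε)` is added to it; this is `extend`.

For `G(A) ∩ A(ε) ⊆ G(A(ε))`, let `A(ε)/Q` be simple with unity and `x ∉ Q`. A simple ring with unity
has zero Jacobson radical, so some maximal right ideal `M ⊇ Q` omits `x`. Then `extend M` is a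
maximal right ideal of `A` with core `extend Q`, its factor anneid is simple, regular and unital,
and `x` is not in it.

For the other inclusion, let `I` be one of the right ideals defining `G(A)`, with core `P`, and let
`x ∈ A(ε)` lie outside `I`, hence outside `P`. A representative `v` of the unity of `A/P` satisfies
`degree v * ε = ε`, so `v ∈ A(ε)` by cancellation. Thus `A(ε)` has a unity modulo `P ∩ A(ε)`, ideals
above this intersection extend to ideals of `A` above `P`, and simplicity passes from `A/P` to
`A(ε)/(P ∩ A(ε))`. -/

/-! ### Factor rings without unity, and maximal right ideals above a maximal ideal -/

theorem TwoSidedIdeal.coe_quotient_eq_zero_iff {R : Type*} [NonUnitalRing R]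
    {I : TwoSidedIdeal R} {x : R} : (x : I.ringCon.Quotient) = 0 ↔ x ∈ I :=
  (RingCon.eq I.ringCon).trans Iff.rfl

/-- The image of an ideal in a factor ring, for rings without unity. -/
def TwoSidedIdeal.quotientMap {R : Type*} [NonUnitalRing R] (I J : TwoSidedIdeal R) :
    TwoSidedIdeal I.ringCon.Quotient :=
  .mk' {s | ∃ r ∈ J, (r : I.ringCon.Quotient) = s}
    ⟨0, J.zero_mem, rfl⟩
    (by rintro _ _ ⟨a, ha, rfl⟩ ⟨b, hb, rfl⟩; exact ⟨a + b, J.add_mem ha hb, rfl⟩)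
    (by rintro _ ⟨a, ha, rfl⟩; exact ⟨-a, J.neg_mem ha, rfl⟩)
    (by
      rintro c _ ⟨a, ha, rfl⟩
      obtain ⟨r, rfl⟩ := Quotient.mk''_surjective c
      exact ⟨r * a, J.mul_mem_left r a ha, rfl⟩)
    (by
      rintro _ c ⟨a, ha, rfl⟩
      obtain ⟨r, rfl⟩ := Quotient.mk''_surjective c
      exact ⟨a * r, J.mul_mem_right a r ha, rfl⟩)

/-- The preimage of an ideal of a factor ring, for rings without unity. -/
def TwoSidedIdeal.quotientComap {R : Type*} [NonUnitalRing R] {I : TwoSidedIdeal R}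
    (K : TwoSidedIdeal I.ringCon.Quotient) : TwoSidedIdeal R :=
  .mk' {r | (r : I.ringCon.Quotient) ∈ K} (by exact K.zero_mem)
    (fun ha hb => by exact K.add_mem ha hb) (fun ha => by exact K.neg_mem ha)
    (fun {x _} ha => by exact K.mul_mem_left (x : I.ringCon.Quotient) _ ha)
    (fun {_ y} ha => by exact K.mul_mem_right _ (y : I.ringCon.Quotient) ha)

theorem TwoSidedIdeal.mem_quotientComap {R : Type*} [NonUnitalRing R] {I : TwoSidedIdeal R}
    {K : TwoSidedIdeal I.ringCon.Quotient} {r : R} :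
    r ∈ quotientComap K ↔ (r : I.ringCon.Quotient) ∈ K :=
  mem_mk' _ _ _ _ _ _ _

theorem TwoSidedIdeal.coe_mem_quotientMap {R : Type*} [NonUnitalRing R] {I J : TwoSidedIdeal R}
    (hIJ : I ≤ J) {r : R} : (r : I.ringCon.Quotient) ∈ I.quotientMap J ↔ r ∈ J := by
  refine (mem_mk' _ _ _ _ _ _ _).trans ⟨?_, fun hr => ⟨r, hr, rfl⟩⟩
  rintro ⟨s, hs, hsr⟩
  have h : s - r ∈ I := (rel_iff I s r).1 ((RingCon.eq _).1 hsr)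
  simpa using J.sub_mem hs (hIJ h)

/-- The correspondence between the ideals containing `I` and the ideals of the factor ring
by `I`, for rings without unity. -/
def TwoSidedIdeal.quotientCorrespondence {R : Type*} [NonUnitalRing R] (I : TwoSidedIdeal R) :
    Set.Ici I ≃o TwoSidedIdeal I.ringCon.Quotient where
  toFun J := I.quotientMap J
  invFun K := ⟨quotientComap K, fun r hr => by
    refine mem_quotientComap.2 ?_
    rw [coe_quotient_eq_zero_iff.2 hr]
    exact K.zero_mem⟩
  left_inv J := Subtype.ext (TwoSidedIdeal.ext fun _ =>
    mem_quotientComap.trans (coe_mem_quotientMap J.2))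
  right_inv K := by
    refine TwoSidedIdeal.ext fun s => ?_
    obtain ⟨r, rfl⟩ := Quotient.mk''_surjective s
    refine (coe_mem_quotientMap fun r hr => ?_).trans mem_quotientComap
    refine mem_quotientComap.2 ?_
    rw [coe_quotient_eq_zero_iff.2 hr]
    exact K.zero_mem
  map_rel_iff' {J K} := by
    constructor
    · exact fun h r hr => (coe_mem_quotientMap K.2).1 (h ((coe_mem_quotientMap J.2).2 hr))
    · intro h s hs
      obtain ⟨r, rfl⟩ := Quotient.mk''_surjective s
      exact (coe_mem_quotientMap K.2).2 (h ((coe_mem_quotientMap J.2).1 hs))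

theorem TwoSidedIdeal.isSimpleRing_quotient_iff_isCoatom {R : Type*} [NonUnitalRing R]
    {I : TwoSidedIdeal R} : IsSimpleRing I.ringCon.Quotient ↔ IsCoatom I := by
  rw [isSimpleRing_iff, ← I.quotientCorrespondence.isSimpleOrder_iff,
    Set.isSimpleOrder_Ici_iff_isCoatom]

/-- The Jacobson radical is a proper two-sided ideal, hence zero in a simple ring. The opposite ring
appears because `Ideal` means left ideal, while right ideals of `S` are needed. -/
theorem IsSimpleRing.exists_isMaximal_mulOpposite {S : Type*} [Ring S] [IsSimpleRing S] {x : S}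
    (hx : x ≠ 0) : ∃ m : Ideal Sᵐᵒᵖ, m.IsMaximal ∧ MulOpposite.op x ∉ m := by
  have h := eq_bot_or_eq_top (TwoSidedIdeal.unop (Ring.jacobson Sᵐᵒᵖ).toTwoSided)
  have hx' : MulOpposite.op x ∉ Ring.jacobson Sᵐᵒᵖ := by
    intro hxJ
    rcases h with h | h
    · have : x ∈ TwoSidedIdeal.unop (Ring.jacobson Sᵐᵒᵖ).toTwoSided := by
        simpa [TwoSidedIdeal.mem_unop_iff] using hxJ
      rw [h] at this
      exact hx (by simpa using this)
    · have : (1 : S) ∈ TwoSidedIdeal.unop (Ring.jacobson Sᵐᵒᵖ).toTwoSided := by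
        rw [h]; trivial
      exact (Ring.jacobson_lt_top Sᵐᵒᵖ).ne ((Ideal.eq_top_iff_one _).2
        (by simpa [TwoSidedIdeal.mem_unop_iff] using this))
  rw [Ring.jacobson, Module.jacobson, Submodule.mem_sInf] at hx'
  push Not at hx'
  obtain ⟨m, hm, hxm⟩ := hx'
  exact ⟨m, ⟨hm⟩, hxm⟩

/-- The predicate of being a right ideal, for additive subgroups of a ring without unity. -/
def AddSubgroup.AbsorbsRight {R : Type*} [NonUnitalRing R] (M : AddSubgroup R) : Prop :=
  ∀ m ∈ M, ∀ r : R, m * r ∈ M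

/-- Pull back to `R` a maximal right ideal of the simple unital ring `R/Q` that omits the class of
`x`. -/
theorem TwoSidedIdeal.exists_maximal_absorbsRight {R : Type*} [NonUnitalRing R]
    {Q : TwoSidedIdeal R} (hQ : IsSimpleRing Q.ringCon.Quotient)
    (h1 : ∃ e : Q.ringCon.Quotient, ∀ x, e * x = x ∧ x * e = x) {x : R} (hx : x ∉ Q) :
    ∃ M : AddSubgroup R, M.AbsorbsRight ∧ (∀ q ∈ Q, q ∈ M) ∧ x ∉ M ∧
      ∀ N : AddSubgroup R, N.AbsorbsRight → M < N → N = ⊤ := by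
  obtain ⟨e, he⟩ := h1
  let instR : Ring Q.ringCon.Quotient :=
    { (inferInstance : NonUnitalRing Q.ringCon.Quotient) with
      one := e
      one_mul := fun x => (he x).1
      mul_one := fun x => (he x).2 }
  have hS : IsSimpleRing Q.ringCon.Quotient := hQ
  obtain ⟨m, hm, hxm⟩ := hS.exists_isMaximal_mulOpposite (x := (x : Q.ringCon.Quotient))
    (fun h => hx (coe_quotient_eq_zero_iff.1 h))
  let φ : R →+ Q.ringCon.Quotient :=
    { toFun := fun r => r, map_zero' := rfl, map_add' := fun _ _ => rfl }
  have hφ : Function.Surjective φ := Quotient.mk''_surjective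
  let M : AddSubgroup R :=
    (m.toAddSubgroup.comap
      (MulOpposite.opAddEquiv : Q.ringCon.Quotient ≃+ _).toAddMonoidHom).comap φ
  have hM (r : R) : r ∈ M ↔ MulOpposite.op (φ r) ∈ m := Iff.rfl
  refine ⟨M, fun a ha r => m.mul_mem_left (MulOpposite.op (φ r)) ha, fun q hq => ?_, hxm, ?_⟩
  · rw [hM, show φ q = 0 from coe_quotient_eq_zero_iff.2 hq]
    exact m.zero_mem
  · intro N hN hMN
    -- The image of `N` in the opposite of the factor ring, to be compared with `m`.
    let n : Ideal (Q.ringCon.Quotient)ᵐᵒᵖ :=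
      { carrier := {s | ∃ r ∈ N, MulOpposite.op (φ r) = s}
        zero_mem' := ⟨0, N.zero_mem, by simp⟩
        add_mem' := by
          rintro _ _ ⟨a, ha, rfl⟩ ⟨b, hb, rfl⟩
          exact ⟨a + b, N.add_mem ha hb, by simp⟩
        smul_mem' := by
          rintro c _ ⟨a, ha, rfl⟩
          obtain ⟨r, hr⟩ := hφ c.unop
          refine ⟨a * r, hN a ha r, ?_⟩
          rw [show φ (a * r) = φ a * φ r from rfl, hr]
          rfl }
    -- `N` contains `M`, hence the kernel of `φ`, so it is the full preimage of its image.
    have hQN (r s : R) (hr : r ∈ N) (hrs : φ r = φ s) : s ∈ N := by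
      have : s - r ∈ M := by
        rw [hM, map_sub, hrs, sub_self]
        exact m.zero_mem
      simpa using N.add_mem (hMN.le this) hr
    have hmn : m < n := by
      refine lt_of_le_of_ne (fun s hs => ?_) ?_
      · obtain ⟨r, hr⟩ := hφ s.unop
        exact ⟨r, hMN.le (by rw [hM, hr]; exact hs), by rw [hr]; rfl⟩
      · rintro h
        refine hMN.not_ge fun r hr => ?_
        rw [hM, h]
        exact ⟨r, hr, rfl⟩
    have hn := hm.out.2 n hmn
    rw [eq_top_iff]
    rintro s -
    have : MulOpposite.op (φ s) ∈ n := by rw [hn]; trivial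
    obtain ⟨r, hr, hrs⟩ := this
    exact hQN r s hr (MulOpposite.op_injective hrs)

namespace Anneid

/-! ### Cancellation in `Δ` for a regular anneid -/

section Degrees

variable {A : Type*} [Anneid A]

theorem Deg.eq_of_mem {D E : Deg A} {a : A} (h0 : a ≠ 0) (hD : a ∈ D.carrier)
    (hE : a ∈ E.carrier) : D = E :=
  Deg.ext (Set.ext fun _ => ⟨fun h => E.mem_of_addable hE h0 (D.addable h hD),
    fun h => D.mem_of_addable hD h0 (E.addable h hE)⟩)

theorem Deg.mul_eq {ξ η ζ : Deg A} {x y : A} (hx : x ∈ ξ.carrier) (hy : y ∈ η.carrier)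
    (h0 : x * y ≠ 0) (h : x * y ∈ ζ.carrier) : ξ * η = ζ :=
  Deg.eq_of_mem h0 (Deg.mul_mem hx hy) h

theorem Deg.ne_zero_of_mem {D : Deg A} {a : A} (h0 : a ≠ 0) (h : a ∈ D.carrier) : D ≠ 0 := by
  rintro rfl
  exact h0 h

theorem Deg.exists_mul_ne_zero {ξ η : Deg A} (h : ξ * η ≠ 0) :
    ∃ x ∈ ξ.carrier, ∃ y ∈ η.carrier, x * y ≠ 0 := by
  classical
  by_contra h'
  refine h (dif_neg ?_)
  rintro ⟨p, h1, h2, h3⟩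
  exact h' ⟨p.1, h1, p.2, h2, h3⟩

theorem Deg.eq_of_addable {ξ ζ : Deg A} {a b : A} (ha0 : a ≠ 0) (hb0 : b ≠ 0)
    (ha : a ∈ ξ.carrier) (hb : b ∈ ζ.carrier) (h : Addable a b) : ξ = ζ :=
  Deg.eq_of_mem ha0 ha (ζ.mem_of_addable hb hb0 h)

/-- Regularity cancels a common element, whereas the two nonzero products witnessing the degrees may
use different right factors `c` and `d`. If neither of these works for both, their sum does. -/
theorem IsRegular.deg_mul_right_cancel (hA : IsRegular A) {ξ ζ η : Deg A} (h0 : ξ * η ≠ 0)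
    (h : ξ * η = ζ * η) : ξ = ζ := by
  obtain ⟨a, ha, c, hc, hac⟩ := Deg.exists_mul_ne_zero h0
  obtain ⟨b, hb, d, hd, hbd⟩ := Deg.exists_mul_ne_zero (h ▸ h0)
  -- a right factor in `η` that annihilates neither `a` nor `b`
  obtain ⟨s, hs, has, hbs⟩ : ∃ s ∈ η.carrier, a * s ≠ 0 ∧ b * s ≠ 0 := by
    by_cases hbc : b * c = 0
    · by_cases had : a * d = 0
      · refine ⟨padd c d, η.padd_mem hc hd, ?_, ?_⟩
        · rwa [mul_padd _ (η.addable hc hd), had, padd_zero]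
        · rwa [mul_padd _ (η.addable hc hd), hbc, zero_padd]
      · exact ⟨d, hd, had, hbd⟩
    · exact ⟨c, hc, hac, hbc⟩
  refine Deg.eq_of_addable (a := a) (b := b) ?_ ?_ ha hb (hA.1 a b s has hbs ?_)
  · rintro rfl; exact has (zero_mul s)
  · rintro rfl; exact hbs (zero_mul s)
  · exact (ξ * η).addable (Deg.mul_mem ha hs) (h ▸ Deg.mul_mem hb hs)

theorem IsRegular.deg_mul_left_cancel (hA : IsRegular A) {ξ ζ η : Deg A} (h0 : η * ξ ≠ 0)
    (h : η * ξ = η * ζ) : ξ = ζ := by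
  obtain ⟨c, hc, a, ha, hca⟩ := Deg.exists_mul_ne_zero h0
  obtain ⟨d, hd, b, hb, hdb⟩ := Deg.exists_mul_ne_zero (h ▸ h0)
  -- a left factor in `η` that annihilates neither `a` nor `b`
  obtain ⟨s, hs, hsa, hsb⟩ : ∃ s ∈ η.carrier, s * a ≠ 0 ∧ s * b ≠ 0 := by
    by_cases hcb : c * b = 0
    · by_cases hda : d * a = 0
      · refine ⟨padd c d, η.padd_mem hc hd, ?_, ?_⟩
        · rwa [padd_mul _ (η.addable hc hd), hda, padd_zero]
        · rwa [padd_mul _ (η.addable hc hd), hcb, zero_padd]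
      · exact ⟨d, hd, hda, hdb⟩
    · exact ⟨c, hc, hca, hcb⟩
  refine Deg.eq_of_addable (a := a) (b := b) ?_ ?_ ha hb (hA.2 a b s hsa hsb ?_)
  · rintro rfl; exact hsa (mul_zero s)
  · rintro rfl; exact hsb (mul_zero s)
  · exact (η * ξ).addable (Deg.mul_mem hs ha) (h ▸ Deg.mul_mem hs hb)

end Degrees

/-! ### Extending ideals of `A(ε)` to ideals of `A` -/

section Extension

variable {A : Type*} [Anneid A] {ε : Deg A} {hε : IsIdempotentElem ε}

/-- The element of the ring `A(ε)` given by an element of the anneid. -/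
def IdemRing.ofMem (hε : IsIdempotentElem ε) (a : A) (ha : a ∈ ε.carrier) : IdemRing ε hε :=
  ⟨a, ha⟩

theorem IdemRing.val_sub (x y : IdemRing ε hε) : (x - y).val = psub x.val y.val :=
  Deg.coe_sub ε x y

/-- `u` is a unity modulo the ideal `Q`. -/
def IsUnityMod {R : Type*} [NonUnitalRing R] (Q : TwoSidedIdeal R) (u : R) : Prop :=
  ∀ x, u * x - x ∈ Q ∧ x * u - x ∈ Q

theorem IsUnityMod.mono {R : Type*} [NonUnitalRing R] {Q J : TwoSidedIdeal R} {u : R}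
    (hu : IsUnityMod Q u) (h : Q ≤ J) : IsUnityMod J u :=
  fun x => ⟨h (hu x).1, h (hu x).2⟩

/-- Replaces the unity of the factor ring by a representative, which can be multiplied with
arbitrary elements of the anneid. -/
theorem exists_isUnityMod_iff {R : Type*} [NonUnitalRing R] {Q : TwoSidedIdeal R} :
    (∃ u, IsUnityMod Q u) ↔ ∃ e : Q.ringCon.Quotient, ∀ x, e * x = x ∧ x * e = x := by
  have key (x y : R) : (x : Q.ringCon.Quotient) = y ↔ x - y ∈ Q :=
    (RingCon.eq _).trans (Q.rel_iff x y)
  constructor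
  · rintro ⟨u, hu⟩
    refine ⟨u, fun x => ?_⟩
    obtain ⟨x, rfl⟩ := Quotient.mk''_surjective x
    exact ⟨(key (u * x) x).2 (hu x).1, (key (x * u) x).2 (hu x).2⟩
  · rintro ⟨e, he⟩
    obtain ⟨u, rfl⟩ := Quotient.mk''_surjective e
    exact ⟨u, fun x => ⟨(key (u * x) x).1 (he x).1, (key (x * u) x).1 (he x).2⟩⟩

/-- If `A(ε)` has a unity modulo `Q`, products outside of `Q` have both factors in `A(ε)`. -/
theorem mem_and_mem_of_mul_notMem (hA : IsRegular A) (hΔ : NoIdempotentFromNonIdempotents A)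
    {Q : TwoSidedIdeal (IdemRing ε hε)} {u : IdemRing ε hε} (hu : IsUnityMod Q u) {a b : A}
    (hab : a * b ∈ ε.carrier) (hQ : IdemRing.ofMem hε (a * b) hab ∉ Q) :
    a ∈ ε.carrier ∧ b ∈ ε.carrier := by
  set p := IdemRing.ofMem hε (a * b) hab
  -- Modulo `Q` both `u * p` and `p * u` agree with `p`, so they too are outside `Q`, in particular
  -- nonzero.
  have hl : u * p ∉ Q := fun h => hQ (by simpa using Q.sub_mem h (hu p).1)
  have hr : p * u ∉ Q := fun h => hQ (by simpa using Q.sub_mem h (hu p).2)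
  have ne_zero {x : IdemRing ε hε} (hx : x ∉ Q) : x.val ≠ 0 := fun h => hx (by
    rw [show x = 0 from Subtype.ext h]; exact Q.zero_mem)
  have hp0 : a * b ≠ 0 := ne_zero hQ
  have hl0 : u.val * a * b ≠ 0 := by rw [mul_assoc]; exact ne_zero hl
  have hr0 : a * (b * u.val) ≠ 0 := by rw [← mul_assoc]; exact ne_zero hr
  -- Both `u * a * b` and `a * b` are nonzero elements of `A(ε)`; regularity cancels `b`. The next
  -- step cancels `a` symmetrically.
  have hua : Addable (u.val * a) a := hA.1 _ _ b hl0 hp0 (by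
    rw [mul_assoc]; exact ε.addable (u * p).2 hab)
  have hbu : Addable (b * u.val) b := hA.2 _ _ a hr0 hp0 (by
    rw [← mul_assoc]; exact ε.addable (p * u).2 hab)
  have ha0 : a ≠ 0 := by rintro rfl; exact hp0 (zero_mul b)
  have hb0 : b ≠ 0 := by rintro rfl; exact hp0 (mul_zero a)
  have hua0 : u.val * a ≠ 0 := fun h => hl0 (by rw [h, zero_mul])
  have hbu0 : b * u.val ≠ 0 := fun h => hr0 (by rw [h, mul_zero])
  have hma := mem_degree_self a
  have hmb := mem_degree_self b
  have e1 : ε * degree a = degree a :=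
    Deg.mul_eq u.2 hma hua0 ((degree a).mem_of_addable hma ha0 hua)
  have e2 : degree b * ε = degree b :=
    Deg.mul_eq hmb u.2 hbu0 ((degree b).mem_of_addable hmb hb0 hbu)
  have e3 : degree a * degree b = ε := Deg.mul_eq hma hmb hp0 hab
  have hε0 : ε ≠ 0 := Deg.ne_zero_of_mem hp0 hab
  have hda0 : degree a ≠ 0 := Deg.ne_zero_of_mem ha0 hma
  have hdb0 : degree b ≠ 0 := Deg.ne_zero_of_mem hb0 hmb
  have hε' : ε * ε = ε := hε
  suffices h : degree a = ε ∧ degree b = ε from ⟨h.1 ▸ hma, h.2 ▸ hmb⟩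
  -- If `degree a` is idempotent, then `ε * degree a = degree a * degree a` gives `degree a = ε`,
  -- and `ε * degree b = ε * ε` gives `degree b = ε`. The case of `degree b` is symmetric, and `hΔ`
  -- excludes that neither is idempotent.
  by_cases hia : IsIdempotentElem (degree a)
  · have ha : ε = degree a :=
      hA.deg_mul_right_cancel (by rwa [e1]) (e1.trans hia.symm)
    rw [← ha] at e3
    exact ⟨ha.symm, hA.deg_mul_left_cancel (by rwa [e3]) (e3.trans hε'.symm)⟩
  by_cases hib : IsIdempotentElem (degree b)
  · have hb : ε = degree b :=
      hA.deg_mul_left_cancel (by rwa [e2]) (e2.trans hib.symm)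
    rw [← hb] at e3
    exact ⟨hA.deg_mul_right_cancel (by rwa [e3]) (e3.trans hε'.symm), hb.symm⟩
  · exact absurd (e3 ▸ hε) (hΔ _ _ hia hib (by rwa [e3]))

/-- The union of a subset of `A(ε)` and the complement of `A(ε)`. -/
def extend (M : Set (IdemRing ε hε)) : Set A :=
  {a | ∀ h : a ∈ ε.carrier, IdemRing.ofMem hε a h ∈ M}

theorem val_mem_extend_iff {M : Set (IdemRing ε hε)} {x : IdemRing ε hε} :
    x.val ∈ extend M ↔ x ∈ M :=
  ⟨fun h => h x.2, fun h _ => h⟩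

/-- A product that falls into `A(ε)` is either in `Q ⊆ M` or has both factors in `A(ε)`, where `M`
absorbs it. -/
theorem IsRightIdeal.extend (hA : IsRegular A) (hΔ : NoIdempotentFromNonIdempotents A)
    {Q : TwoSidedIdeal (IdemRing ε hε)} {u : IdemRing ε hε} (hu : IsUnityMod Q u)
    {M : AddSubgroup (IdemRing ε hε)} (hM : M.AbsorbsRight) (hQM : ∀ q ∈ Q, q ∈ M) :
    IsRightIdeal (Anneid.extend (M : Set (IdemRing ε hε))) where
  nonempty := ⟨0, fun _ => M.zero_mem⟩
  psub_mem := by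
    intro a ha b hb hab h
    obtain ⟨D, haD, hbD⟩ := hab.exists_deg
    have hD : psub a b ∈ D.carrier := D.padd_mem haD (D.neg_mem hbD)
    -- A nonzero difference in `A(ε)` forces the common degree of `a` and `b` to be `ε`.
    by_cases h0 : psub a b = 0
    · rw [show IdemRing.ofMem hε _ h = 0 from Subtype.ext h0]
      exact M.zero_mem
    · obtain rfl := Deg.eq_of_mem h0 hD h
      have e : IdemRing.ofMem hε (psub a b) h =
          IdemRing.ofMem hε a haD - IdemRing.ofMem hε b hbD :=
        Subtype.ext (IdemRing.val_sub (IdemRing.ofMem hε a haD) (IdemRing.ofMem hε b hbD)).symm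
      rw [e]
      exact M.sub_mem (ha haD) (hb hbD)
  mul_mem := by
    intro a ha x h
    by_cases hQ : IdemRing.ofMem hε (a * x) h ∈ Q
    · exact hQM _ hQ
    · obtain ⟨h1, h2⟩ := mem_and_mem_of_mul_notMem hA hΔ hu h hQ
      exact hM _ (ha h1) (IdemRing.ofMem hε x h2)

theorem IsIdeal.extend (hA : IsRegular A) (hΔ : NoIdempotentFromNonIdempotents A)
    {Q : TwoSidedIdeal (IdemRing ε hε)} {u : IdemRing ε hε} (hu : IsUnityMod Q u) :
    IsIdeal (Anneid.extend (Q : Set (IdemRing ε hε))) where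
  toIsRightIdeal := IsRightIdeal.extend (M := AddSubgroup.ofClass Q) hA hΔ hu
    (fun m hm r => Q.mul_mem_right m r hm) fun _ hq => hq
  mul_mem_left := by
    intro a ha x h
    by_contra hQ
    obtain ⟨h1, h2⟩ := mem_and_mem_of_mul_notMem hA hΔ hu h hQ
    exact hQ (Q.mul_mem_left (IdemRing.ofMem hε x h1) _ (ha h2))

end Extension

/-! ### Factor anneids: regularity and the ideal correspondence -/

section Factor

variable {A : Type*} [Anneid A] {P : Set A} {hP : IsIdeal P}

theorem IsRegular.factor (hA : IsRegular A) : IsRegular (Factor P hP) := by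
  -- For nonzero classes, addability does not depend on the representatives, so regularity can be
  -- applied in `A` itself.
  have key {x y : A} (hx : Factor.mk P hP x ≠ 0) (hy : Factor.mk P hP y ≠ 0)
      (h : Addable (Factor.mk P hP x) (Factor.mk P hP y)) : Addable x y := by
    obtain ⟨b, hb, hby⟩ := Factor.exists_addable_rep hy h
    have hb0 : b ≠ 0 := by rintro rfl; exact hx hb.symm
    rcases Factor.mk_eq.1 hb with h1 | h1
    · exact absurd (Factor.mk_eq_zero.2 h1.2) hx
    · exact addable_trans (addable_symm h1.1) hby hb0
  have ne_zero {x : A} (hx : Factor.mk P hP x ≠ 0) : x ≠ 0 := by rintro rfl; exact hx rfl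
  constructor
  · intro x y z hx hy h
    obtain ⟨a, rfl⟩ := Factor.exists_mk x
    obtain ⟨b, rfl⟩ := Factor.exists_mk y
    obtain ⟨c, rfl⟩ := Factor.exists_mk z
    exact ⟨(a, b), rfl, rfl, hA.1 a b c (ne_zero hx) (ne_zero hy) (key hx hy h)⟩
  · intro x y z hx hy h
    obtain ⟨a, rfl⟩ := Factor.exists_mk x
    obtain ⟨b, rfl⟩ := Factor.exists_mk y
    obtain ⟨c, rfl⟩ := Factor.exists_mk z
    exact ⟨(a, b), rfl, rfl, hA.2 a b c (ne_zero hx) (ne_zero hy) (key hx hy h)⟩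

/-- The preimage in `A` of an ideal of a factor anneid. -/
theorem IsIdeal.preimage_mk {J : Set (Factor P hP)} (hJ : IsIdeal J) :
    IsIdeal (Factor.mk P hP ⁻¹' J) where
  nonempty := ⟨0, hJ.zero_mem⟩
  psub_mem a ha b hb hab := by
    have h := hJ.psub_mem _ ha _ hb ⟨(a, b), rfl, rfl, hab⟩
    obtain ⟨D, haD, hbD⟩ := hab.exists_deg
    rwa [psub, show padd (Factor.mk P hP a) (-Factor.mk P hP b) = _ from
      Factor.sum_mk (D.addable haD (D.neg_mem hbD))] at h
  mul_mem a ha x := hJ.mul_mem _ ha (Factor.mk P hP x)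
  mul_mem_left a ha x := hJ.mul_mem_left _ ha (Factor.mk P hP x)

/-- The image in a factor anneid of an ideal of `A`. -/
theorem IsIdeal.image_mk {K : Set A} (hK : IsIdeal K) (hPK : P ⊆ K) :
    IsIdeal (Factor.mk P hP '' K) where
  nonempty := hK.nonempty.image _
  psub_mem := by
    rintro _ ⟨a, ha, rfl⟩ _ ⟨b, hb, rfl⟩ h
    -- If `b ∈ P`, the difference is just the class of `a`. Otherwise the class of `a` has a
    -- representative addable with `b`, and it stays in `K` because `P ⊆ K`.
    by_cases hbP : b ∈ P
    · refine ⟨a, ha, ?_⟩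
      rw [Factor.mk_eq_zero.2 hbP, psub]
      exact (padd_zero _).symm.trans (congrArg _ neg_zero'.symm)
    · obtain ⟨c, hc, hcb⟩ := Factor.exists_addable_rep (fun e => hbP (Factor.mk_eq_zero.1 e)) h
      have hcK : c ∈ K := by
        rcases Factor.mk_eq.1 hc with h1 | ⟨h1, h2⟩
        · exact hPK h1.1
        · exact (modRel_mem hK (Or.inr ⟨h1, hPK h2⟩)).2 ha
      refine ⟨psub c b, hK.psub_mem c hcK b hb hcb, ?_⟩
      rw [← hc]
      obtain ⟨D, hcD, hbD⟩ := hcb.exists_deg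
      exact (Factor.sum_mk (D.addable hcD (D.neg_mem hbD))).symm
  mul_mem := by
    rintro _ ⟨a, ha, rfl⟩ x
    obtain ⟨c, rfl⟩ := Factor.exists_mk x
    exact ⟨a * c, hK.mul_mem a ha c, rfl⟩
  mul_mem_left := by
    rintro _ ⟨a, ha, rfl⟩ x
    obtain ⟨c, rfl⟩ := Factor.exists_mk x
    exact ⟨c * a, hK.mul_mem_left a ha c, rfl⟩

theorem Factor.mk_mem_image_iff {K : Set A} (hK : IsIdeal K) (hPK : P ⊆ K) {a : A} :
    Factor.mk P hP a ∈ Factor.mk P hP '' K ↔ a ∈ K := by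
  refine ⟨?_, fun h => ⟨a, h, rfl⟩⟩
  rintro ⟨b, hb, hba⟩
  rcases Factor.mk_eq.1 hba with h1 | ⟨h1, h2⟩
  · exact hPK h1.2
  · exact (modRel_mem hK (Or.inr ⟨h1, hPK h2⟩)).1 hb

/-- Factor anneids by maximal ideals have no nontrivial ideals, and conversely. -/
theorem Factor.forall_isIdeal_iff :
    (∀ J : Set (Factor P hP), IsIdeal J → J = {0} ∨ J = Set.univ) ↔
      ∀ K : Set A, IsIdeal K → P ⊆ K → K = P ∨ K = Set.univ := by
  constructor
  · intro h K hK hPK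
    refine (h _ (hK.image_mk (hP := hP) hPK)).imp (fun e => ?_) (fun e => ?_)
    · ext a
      rw [← mk_mem_image_iff (hP := hP) hK hPK, e]
      exact Factor.mk_eq_zero
    · ext a
      rw [← mk_mem_image_iff (hP := hP) hK hPK, e]
      exact iff_of_true trivial trivial
  · intro h J hJ
    have hPJ : P ⊆ Factor.mk P hP ⁻¹' J := fun a ha => by
      rw [Set.mem_preimage, Factor.mk_eq_zero.2 ha]
      exact hJ.zero_mem
    refine (h _ (IsIdeal.preimage_mk hJ) hPJ).imp (fun e => ?_) (fun e => ?_)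
    · ext x
      obtain ⟨a, rfl⟩ := Factor.exists_mk x
      exact (Set.ext_iff.1 e a).trans Factor.mk_eq_zero.symm
    · ext x
      obtain ⟨a, rfl⟩ := Factor.exists_mk x
      exact Set.ext_iff.1 e a

end Factor

end Anneid

namespace Anneid

/-! ### Comparing the ideals that define the two radicals -/

section Radicals

variable {A : Type*} [Anneid A] {ε : Deg A} {hε : IsIdempotentElem ε}

/-- The intersection of a right ideal with `A(ε)`. -/
def IsRightIdeal.restrict {I : Set A} (hI : IsRightIdeal I) (hε : IsIdempotentElem ε) :
    AddSubgroup (IdemRing ε hε) := hI.part ε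

theorem IsRightIdeal.mem_restrict {I : Set A} (hI : IsRightIdeal I) {x : IdemRing ε hε} :
    x ∈ hI.restrict hε ↔ x.val ∈ I := Iff.rfl

theorem IsRightIdeal.absorbsRight_restrict {I : Set A} (hI : IsRightIdeal I) :
    (hI.restrict hε).AbsorbsRight := fun _ hm r => hI.mul_mem _ hm r.val

/-- The intersection of an ideal with `A(ε)`. -/
def IsIdeal.restrict {K : Set A} (hK : IsIdeal K) (hε : IsIdempotentElem ε) :
    TwoSidedIdeal (IdemRing ε hε) :=
  .mk' (hK.toIsRightIdeal.restrict hε) (zero_mem _) (add_mem (S := AddSubgroup _))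
    (neg_mem (S := AddSubgroup _)) (fun {x _} hy => hK.mul_mem_left _ hy x.val)
    (fun {_ y} hx => hK.mul_mem _ hx y.val)

theorem IsIdeal.mem_restrict {K : Set A} (hK : IsIdeal K) {x : IdemRing ε hε} :
    x ∈ hK.restrict hε ↔ x.val ∈ K :=
  TwoSidedIdeal.mem_mk' _ _ _ _ _ _ _

/-- `K` already contains everything outside `A(ε)`, so it is determined by `K ∩ A(ε)`, an ideal
lying above the maximal ideal `Q`. -/
theorem eq_extend_or_eq_univ_of_isCoatom {Q : TwoSidedIdeal (IdemRing ε hε)} (hQ : IsCoatom Q)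
    {K : Set A} (hK : IsIdeal K) (hQK : extend (Q : Set (IdemRing ε hε)) ⊆ K) :
    K = extend (Q : Set (IdemRing ε hε)) ∨ K = Set.univ := by
  have hle : Q ≤ hK.restrict hε := fun x hx =>
    hK.mem_restrict.2 (hQK (val_mem_extend_iff.2 hx))
  rcases hQ.le_iff.1 hle with h | h
  · refine Or.inr (Set.eq_univ_of_forall fun a => ?_)
    by_cases ha : a ∈ ε.carrier
    · have : IdemRing.ofMem hε a ha ∈ hK.restrict hε := by rw [h]; trivial
      exact hK.mem_restrict.1 this
    · exact hQK fun h => absurd h ha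
  · refine Or.inl (Set.Subset.antisymm (fun a ha h' => ?_) hQK)
    have : IdemRing.ofMem hε a h' ∈ hK.restrict hε := hK.mem_restrict.2 ha
    rwa [h] at this

theorem isMaximalRightIdeal_extend (hA : IsRegular A) (hΔ : NoIdempotentFromNonIdempotents A)
    {Q : TwoSidedIdeal (IdemRing ε hε)} {u : IdemRing ε hε} (hu : IsUnityMod Q u)
    {M : AddSubgroup (IdemRing ε hε)} (hM : M.AbsorbsRight) (hQM : ∀ q ∈ Q, q ∈ M)
    (hM1 : M ≠ ⊤) (hmax : ∀ N : AddSubgroup (IdemRing ε hε), N.AbsorbsRight → M < N → N = ⊤) :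
    IsMaximalRightIdeal (extend (M : Set (IdemRing ε hε))) := by
  refine ⟨⟨IsRightIdeal.extend hA hΔ hu hM hQM, fun h => hM1 ?_⟩, ?_⟩
  · exact (AddSubgroup.eq_top_iff' M).2 fun x => val_mem_extend_iff.1 (h ▸ Set.mem_univ x.val)
  · rintro J ⟨hJ, hJ1⟩ hIJ a ha h
    have hle : M ≤ hJ.restrict hε := fun x hx =>
      hJ.mem_restrict.2 (hIJ (val_mem_extend_iff.2 hx))
    -- `J` contains the complement of `A(ε)`, so only its part in `A(ε)` matters, and this part is
    -- `M` or everything.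
    rcases hle.eq_or_lt with he | hlt
    · have : IdemRing.ofMem hε a h ∈ hJ.restrict hε := hJ.mem_restrict.2 ha
      rwa [← he] at this
    · refine absurd (Set.eq_univ_of_forall fun b => ?_) hJ1
      by_cases hb : b ∈ ε.carrier
      · have : IdemRing.ofMem hε b hb ∈ hJ.restrict hε := by
          rw [hmax _ hJ.absorbsRight_restrict hlt]; trivial
        exact hJ.mem_restrict.1 this
      · exact hIJ fun h => absurd h hb

/-- Elements outside `A(ε)` vanish in the factor, so `u` is a unity there. The equation `hPQ` is a
hypothesis so that `P` can be a core only proved equal to `extend Q`. -/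
theorem isSimpleRegularUnital_factor_extend (hA : IsRegular A)
    {Q : TwoSidedIdeal (IdemRing ε hε)} {u : IdemRing ε hε} (hu : IsUnityMod Q u)
    (hQ : IsCoatom Q) {P : Set A} (hP : IsIdeal P)
    (hPQ : P = extend (Q : Set (IdemRing ε hε))) : IsSimpleRegularUnital (Factor P hP) where
  regular := hA.factor
  exists_unity := by
    refine ⟨Factor.mk P hP u.val, fun x => ?_⟩
    obtain ⟨a, rfl⟩ := Factor.exists_mk x
    by_cases ha : a ∈ ε.carrier
    · have h := hu (IdemRing.ofMem hε a ha)
      have mem {x y : IdemRing ε hε} (hxy : x - y ∈ Q) : modRel P x.val y.val := by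
        refine Or.inr ⟨ε.addable x.2 y.2, ?_⟩
        rw [← IdemRing.val_sub, hPQ]
        exact val_mem_extend_iff.2 hxy
      exact ⟨Factor.mk_eq.2 (mem h.1), Factor.mk_eq.2 (mem h.2)⟩
    · have haP : a ∈ P := by rw [hPQ]; exact fun h => absurd h ha
      exact ⟨Factor.mk_eq.2 (Or.inl ⟨hP.mul_mem_left a haP _, haP⟩),
        Factor.mk_eq.2 (Or.inl ⟨hP.mul_mem a haP _, haP⟩)⟩
  simple := by
    rw [Factor.forall_isIdeal_iff]
    subst hPQ
    exact fun K => eq_extend_or_eq_univ_of_isCoatom hQ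

theorem mem_of_val_mem_gradedBrownMcCoy (hA : IsRegular A)
    (hΔ : NoIdempotentFromNonIdempotents A) {Q : TwoSidedIdeal (IdemRing ε hε)}
    (hQ : IsSimpleRing Q.ringCon.Quotient)
    (h1 : ∃ e : Q.ringCon.Quotient, ∀ x, e * x = x ∧ x * e = x) {x : IdemRing ε hε}
    (hx : x.val ∈ gradedBrownMcCoy A) : x ∈ Q := by
  by_contra hxQ
  obtain ⟨u, hu⟩ := exists_isUnityMod_iff.2 h1
  obtain ⟨M, hM, hQM, hxM, hmax⟩ := TwoSidedIdeal.exists_maximal_absorbsRight hQ h1 hxQ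
  have hI := isMaximalRightIdeal_extend hA hΔ hu hM hQM (by rintro rfl; exact hxM trivial) hmax
  have hQc := TwoSidedIdeal.isSimpleRing_quotient_iff_isCoatom.1 hQ
  have hsub : extend (Q : Set (IdemRing ε hε)) ⊆ core (extend (M : Set (IdemRing ε hε))) :=
    fun a ha => ⟨_, IsIdeal.extend hA hΔ hu, fun b hb h => hQM _ (hb h), ha⟩
  have hle := (isGreatest_core hI.prop.1).1.2
  -- The core contains `extend Q` and lies in the proper right ideal `extend M`, so it cannot be all
  -- of `A`.
  have hcore := (eq_extend_or_eq_univ_of_isCoatom hQc hI.prop.1.core_isIdeal hsub).resolve_right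
    fun h => hI.prop.2 (Set.univ_subset_iff.1 (h ▸ hle))
  exact hxM (val_mem_extend_iff.1
    (hx _ ⟨hI, isSimpleRegularUnital_factor_extend hA hu hQc _ hcore⟩))

/-- The element `a` ties the unity of `A/P` to `A(ε)`: any representative `v` of the unity is forced
to have degree `ε`. -/
theorem isSimpleRing_quotient_restrict (hA : IsRegular A)
    (hΔ : NoIdempotentFromNonIdempotents A) (hε : IsIdempotentElem ε) {P : Set A}
    (hP : IsIdeal P) (hB : IsSimpleRegularUnital (Factor P hP)) {a : A} (ha : a ∈ ε.carrier)
    (haP : a ∉ P) : IsSimpleRing (hP.restrict hε).ringCon.Quotient ∧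
      ∃ e : (hP.restrict hε).ringCon.Quotient, ∀ x, e * x = x ∧ x * e = x := by
  obtain ⟨e, he⟩ := hB.exists_unity
  obtain ⟨v, rfl⟩ := Factor.exists_mk e
  have hmod (b : A) : modRel P (v * b) b ∧ modRel P (b * v) b :=
    ⟨Factor.mk_eq.1 (he (Factor.mk P hP b)).1, Factor.mk_eq.1 (he (Factor.mk P hP b)).2⟩
  have ne_zero {b : A} (hb : b ∉ P) : b ≠ 0 := fun h => hb (h ▸ hP.zero_mem)
  have hva : Addable (v * a) a := ((hmod a).1.resolve_left fun h => haP h.2).1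
  have hvaP : v * a ∉ P := fun h => haP ((modRel_mem hP (hmod a).1).1 h)
  have hdeg : degree v * ε = ε := Deg.mul_eq (mem_degree_self v) ha (ne_zero hvaP)
    (ε.mem_of_addable ha (ne_zero haP) hva)
  have hε0 : ε ≠ 0 := Deg.ne_zero_of_mem (ne_zero haP) ha
  -- Cancel `ε` on the right in `degree v * ε = ε * ε`.
  have hvε : degree v = ε :=
    hA.deg_mul_right_cancel (by rwa [hdeg]) (hdeg.trans (show ε * ε = ε from hε).symm)
  have hv : v ∈ ε.carrier := hvε ▸ mem_degree_self v
  have hu : IsUnityMod (hP.restrict hε) (IdemRing.ofMem hε v hv) := by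
    have mem {x y : IdemRing ε hε} (h : modRel P x.val y.val) : x - y ∈ hP.restrict hε := by
      rcases h with ⟨h1, h2⟩ | ⟨-, h⟩
      · exact sub_mem (hP.mem_restrict.2 h1) (hP.mem_restrict.2 h2)
      · rw [hP.mem_restrict, IdemRing.val_sub]
        exact h
    exact fun x => ⟨mem (hmod x.val).1, mem (hmod x.val).2⟩
  refine ⟨TwoSidedIdeal.isSimpleRing_quotient_iff_isCoatom.2 ⟨fun h => haP ?_, fun J hJ => ?_⟩,
    exists_isUnityMod_iff.1 ⟨_, hu⟩⟩
  · have : IdemRing.ofMem hε a ha ∈ hP.restrict hε := by rw [h]; trivial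
    exact hP.mem_restrict.1 this
  -- `v` remains a unity modulo the larger `J`, so `extend J` is an ideal of `A` above `P`. Equality
  -- with `P` would give `J ≤ P ∩ A(ε)`, so `extend J` is all of `A`.
  · have hPJ : P ⊆ extend (J : Set (IdemRing ε hε)) := fun b hb h =>
      hJ.le ((hP.mem_restrict (x := IdemRing.ofMem hε b h)).2 hb)
    rcases Factor.forall_isIdeal_iff.1 hB.simple _ (IsIdeal.extend hA hΔ (hu.mono hJ.le)) hPJ
      with h | h
    · refine absurd (fun x hx => hP.mem_restrict.2 ?_) hJ.not_ge
      rw [← h]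
      exact val_mem_extend_iff.2 hx
    · refine eq_top_iff.2 fun x _ => ?_
      exact val_mem_extend_iff.1 (h ▸ Set.mem_univ x.val)

end Radicals

end Anneid

theorem mainTheorem3 {A : Type*} [Anneid A] (hA : Anneid.IsRegular A)
    (hΔ : Anneid.NoIdempotentFromNonIdempotents A) (ε : Anneid.Deg A) (hε0 : ε ≠ 0)
    (hε : IsIdempotentElem ε) :
    Anneid.IdemRing.val '' (brownMcCoyRadical (Anneid.IdemRing ε hε) : Set (Anneid.IdemRing ε hε))
      = Anneid.gradedBrownMcCoy A ∩ ε.carrier := by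
  ext a
  constructor
  · rintro ⟨x, hx, rfl⟩
    refine ⟨?_, x.2⟩
    rintro I ⟨hI, hB⟩
    by_contra hxI
    have hc := hI.prop.1.core_isIdeal
    have hxc : x.val ∉ Anneid.core I :=
      fun h => hxI ((Anneid.isGreatest_core hI.prop.1).1.2 h)
    have hmem : hc.restrict hε ∈ {J : TwoSidedIdeal (Anneid.IdemRing ε hε) |
        IsSimpleRing J.ringCon.Quotient ∧
          ∃ e : J.ringCon.Quotient, ∀ x, e * x = x ∧ x * e = x} :=
      Anneid.isSimpleRing_quotient_restrict hA hΔ hε hc hB x.2 hxc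
    exact hxc (hc.mem_restrict.1 (sInf_le hmem hx))
  · rintro ⟨ha, haε⟩
    refine ⟨Anneid.IdemRing.ofMem hε a haε, ?_, rfl⟩
    exact (TwoSidedIdeal.mem_sInf _).2 fun J hJ =>
      Anneid.mem_of_val_mem_gradedBrownMcCoy hA hΔ hJ.1 hJ.2 ha
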